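/- Let $X\neq\{0\}$ be a real separable Hilbert space, of finite or infinite dimension $d\in\{1,2,\dots\}\cup\{\infty\}$, and let $\varphi=\{\varphi_n\}_{1\le n\le d}$ (all $n\ge 1$ if $d=\infty$) be any orthonormal basis of $X$. For an integer $1\le N\le d$ put $$E_N:X\to\mathbb R^N,\ E_Nu=(\langle u,\varphi_1\rangle,\dots,\langle u,\varphi_N\rangle),\qquad D_N:\mathbb R^N\to X,\ D_N\alpha=\sum_{n=1}^N\alpha_n\varphi_n .$$ Let $\sigma$ be the GroupSort activation with group size $2$: the units of each hidden layer are split into consecutive pairs, and the two entries of every pair are sorted in ascending order. A neural network with activation $\sigma$ is a feed-forward network with at least one hidden layer, arbitrary real weights and biases, arbitrarily many hidden layers of arbitrary even widths, and an affine output layer. For $\delta\in(0,1)$ and integers $T\ge1$, $1\le N\le d$, let $\mathcal R^{inv}_{T,N,\varphi,\delta,\sigma}(X)$ be the set of maps $$G=(\mathrm{Id}_X+D_N\circ NN_T\circ E_N)\circ\cdots\circ(\mathrm{Id}_X+D_N\circ NN_1\circ E_N),$$ where each $NN_t:\mathbb R^N\to\mathbb R^N$ is a neural network with activation $\sigma$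 and $\mathrm{Lip}_{X\to X}(D_N\circ NN_t\circ E_N)\le\delta$ for $t=1,\dots,T$. **Theorem.** Let $R>0$ and let $F:X\to X$ be a $C^1$-diffeomorphism that is strongly monotone (there is $\alpha>0$ with $\langle F(x)-F(y),x-y\rangle\ge\alpha\|x-y\|^2$ for all $x,y\in X$) and has compact support, i.e. $\mathrm{supp}(F):=\overline{\{x\in X: F(x)\neq x\}}$ is compact. Then for every orthonormal basis $\varphi$ as above, every $\delta\in(0,1)$ and every $\epsilon\in(0,1)$ there are integers $T\ge 1$, $1\le N\le d$ and a map $G\in\mathcal R^{inv}_{T,N,\varphi,\delta,\sigma}(X)$ with $$\sup_{u\in\overline B_X(0,R)}\|F(u)-G(u)\|_X\le\epsilon .$$ Moreover, every $G\in\mathcal R^{inv}_{T,N,\varphi,\delta,\sigma}(X)$, written with networks $NN_1,\dots,NN_T$ as above, is a bijection of $X$, and its inverse is $$G^{-1}=\tilde L_1\circ\cdots\circ\tilde L_{T-1}\circ\tilde L_T,\qquad \tilde L_t(y):=\lim_{n\to\infty}\pi_1\Bigl(\tilde\phi_t^{\,n}(0,y)\Bigr)\quad(y\in X),$$ where the limits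 exist for all $y\in X$, $\tilde\phi_t^{\,n}$ is the $n$-fold composition of $$\tilde\phi_t:X\times X\to X\times X,\qquad \tilde\phi_t(x,y)=\bigl(y-D_N\circ NN_t\circ E_N(x),\,y\bigr),$$ and $\pi_1(x,y)=x$. -/

import Mathlib

open Filter Topology Set Metric
open scoped NNReal RealInnerProductSpace Matrix Manifold ContDiff

/-- Strong monotonicity of a nonlinear operator on a real Hilbert space. -/
def StronglyMonotone {X : Type*} [NormedAddCommGroup X] [InnerProductSpace ℝ X]
    (F : X → X) : Prop :=
  ∃ α : ℝ, 0 < α ∧ ∀ x y : X, α * ‖x - y‖ ^ 2 ≤ ⟪F x - F y, x - y⟫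

/-- The support of a self-map, `supp F`: the closure of the set of points moved by `F`. -/
def moveSupport {X : Type*} [TopologicalSpace X] (F : X → X) : Set X :=
  closure {x | F x ≠ x}

/-- `φ 0, φ 1, …` (all indices `n < d`) is an orthonormal basis of `X`, where `d = ⊤` means a
basis `(φ n)` indexed by all of `ℕ`, and `d < ⊤` means the finite basis `φ 0, …, φ (d - 1)`.
Values `φ n` with `n ≥ d` are irrelevant. -/
structure IsSeqOrthonormalBasis {X : Type*} [NormedAddCommGroup X] [InnerProductSpace ℝ X]
    (d : ℕ∞) (φ : ℕ → X) : Prop where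
  orthonormal : Orthonormal ℝ (fun n : {n : ℕ // (n : ℕ∞) < d} => φ n)
  dense_span : (Submodule.span ℝ (φ '' {n : ℕ | (n : ℕ∞) < d})).topologicalClosure = ⊤

/-- `E_N u = (⟨u, φ_0⟩, …, ⟨u, φ_{N-1}⟩)`. -/
noncomputable def encoder {X : Type*} [NormedAddCommGroup X] [InnerProductSpace ℝ X]
    (φ : ℕ → X) (N : ℕ) (u : X) : Fin N → ℝ :=
  fun n => ⟪u, φ n⟫

/-- `D_N α = ∑_{n < N} α_n φ_n`. -/
noncomputable def decoder {X : Type*} [NormedAddCommGroup X] [InnerProductSpace ℝ X]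
    (φ : ℕ → X) (N : ℕ) (α : Fin N → ℝ) : X :=
  ∑ n : Fin N, α n • φ n

/-- The GroupSort activation on one group of size `g`: it rearranges the entries in
ascending order. -/
noncomputable def groupSort (g : ℕ) (v : Fin g → ℝ) : Fin g → ℝ :=
  v ∘ Tuple.sort v

/-- An activation function `σ` of group size `g` acts on a layer made of `k` groups of `g` units
separately on each group (`g = 1` is the case of an activation acting element-wise). -/
def activate {g k : ℕ} (σ : (Fin g → ℝ) → (Fin g → ℝ)) (v : Fin k × Fin g → ℝ) :
    Fin k × Fin g → ℝ :=
  fun p => σ (fun j => v (p.1, j)) p.2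

/-- The functions computed by the last hidden layer of a feed-forward network with input
dimension `m` and activation `σ`; weights and biases are arbitrary, every hidden layer consists
of an arbitrary number of groups, and there is at least one hidden layer. -/
inductive IsHiddenLayer {g : ℕ} (σ : (Fin g → ℝ) → (Fin g → ℝ)) (m : ℕ) :
    (k : ℕ) → ((Fin m → ℝ) → (Fin k × Fin g → ℝ)) → Prop
  | first (k : ℕ) (W : Matrix (Fin k × Fin g) (Fin m) ℝ) (b : Fin k × Fin g → ℝ) :
      IsHiddenLayer σ m k (fun x => activate σ (W *ᵥ x + b))
  | next (k l : ℕ) (h : (Fin m → ℝ) → (Fin k × Fin g → ℝ)) (hh : IsHiddenLayer σ m k h)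
      (W : Matrix (Fin l × Fin g) (Fin k × Fin g) ℝ) (b : Fin l × Fin g → ℝ) :
      IsHiddenLayer σ m l (fun x => activate σ (W *ᵥ h x + b))

/-- `f : ℝ^m → ℝ^n` is a feed-forward neural network with activation `σ`
(hidden layers followed by an affine output layer). -/
def IsNeuralNetwork {g : ℕ} (σ : (Fin g → ℝ) → (Fin g → ℝ)) {m n : ℕ}
    (f : (Fin m → ℝ) → (Fin n → ℝ)) : Prop :=
  ∃ (k : ℕ) (h : (Fin m → ℝ) → (Fin k × Fin g → ℝ)), IsHiddenLayer σ m k h ∧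
    ∃ (W : Matrix (Fin n) (Fin k × Fin g) ℝ) (b : Fin n → ℝ), f = fun x => W *ᵥ h x + b

/-- `f_T ∘ ⋯ ∘ f_1` (with indices shifted to start at `0`). -/
def compForward {X : Type*} : (T : ℕ) → (Fin T → X → X) → X → X
  | 0, _ => id
  | T + 1, f => f (Fin.last T) ∘ compForward T (fun t => f t.castSucc)

/-- `f_1 ∘ ⋯ ∘ f_T` (with indices shifted to start at `0`). -/
def compBackward {X : Type*} : (T : ℕ) → (Fin T → X → X) → X → X
  | 0, _ => id
  | T + 1, f => compBackward T (fun t => f t.castSucc) ∘ f (Fin.last T)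

/-- The finite-rank residual `D_N ∘ NN ∘ E_N : X → X`. -/
noncomputable def rankResidual {X : Type*} [NormedAddCommGroup X] [InnerProductSpace ℝ X]
    (φ : ℕ → X) (N : ℕ) (NN : (Fin N → ℝ) → (Fin N → ℝ)) : X → X :=
  decoder φ N ∘ NN ∘ encoder φ N

/-- `(Id + D_N ∘ NN_T ∘ E_N) ∘ ⋯ ∘ (Id + D_N ∘ NN_1 ∘ E_N)`. -/
noncomputable def resNetMap {X : Type*} [NormedAddCommGroup X] [InnerProductSpace ℝ X]
    (φ : ℕ → X) (T N : ℕ) (NN : Fin T → (Fin N → ℝ) → (Fin N → ℝ)) : X → X :=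
  compForward T (fun t x => x + rankResidual φ N (NN t) x)

/-- The networks `NN_1, …, NN_T` have activation `σ`, and each residual `D_N ∘ NN_t ∘ E_N` is
`δ`-Lipschitz from `X` to `X`. -/
def IsInvBlockFamily {X : Type*} [NormedAddCommGroup X] [InnerProductSpace ℝ X]
    {g : ℕ} (T N : ℕ) (φ : ℕ → X) (δ : ℝ≥0) (σ : (Fin g → ℝ) → (Fin g → ℝ))
    (NN : Fin T → (Fin N → ℝ) → (Fin N → ℝ)) : Prop :=
  ∀ t, IsNeuralNetwork σ (NN t) ∧ LipschitzWith δ (rankResidual φ N (NN t))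

/-- The class `R^inv_{T,N,φ,δ,σ}(X)` of invertible residual networks. -/
def invResNets {X : Type*} [NormedAddCommGroup X] [InnerProductSpace ℝ X]
    {g : ℕ} (T N : ℕ) (φ : ℕ → X) (δ : ℝ≥0) (σ : (Fin g → ℝ) → (Fin g → ℝ)) :
    Set (X → X) :=
  {G | ∃ NN : Fin T → (Fin N → ℝ) → (Fin N → ℝ),
    IsInvBlockFamily T N φ δ σ NN ∧ G = resNetMap φ T N NN}

/-- One step `(x, y) ↦ (y - D_N (NN (E_N x)), y)` of the fixed-point iteration that solves
`x + D_N (NN (E_N x)) = y` for `x`. -/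
noncomputable def fixedPointStep {X : Type*} [NormedAddCommGroup X] [InnerProductSpace ℝ X]
    (φ : ℕ → X) (N : ℕ) (NN : (Fin N → ℝ) → (Fin N → ℝ)) : X × X → X × X :=
  fun p => (p.2 - rankResidual φ N NN p.1, p.2)

/-! Put `P = F - Id`, which is continuous with compact support. If `X` is infinite-dimensional this
forces `P = 0`, and a zero network suffices. Otherwise take `N = d`, so that `D_N ∘ E_N = Id`, and
use that `P` is `C`-Lipschitz. By strong monotonicity the maps `H_t = Id + t P`, `0 ≤ t ≤ 1`, are
antilipschitz with a common constant `a`, and `H_{(j+1)/n} = (Id + g_j) ∘ H_{j/n}` with `g_j = n⁻¹ P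
∘ H_{j/n}⁻¹` of Lipschitz constant `C a / n`. Thus `F` is a composition of `n` near-identity maps
(`exists_isResNetLimit_of_stronglyMonotone`).

Each `g_j` is approximated coordinatewise by min-max combinations of affine functions of slope at
most `C a / n` (`exists_isAffineLattice_approx`). These keep the Lipschitz bound globally and are
computed exactly by GroupSort networks (`isNeuralNetwork_of_isAffineLattice`). The inversion formula
is Banach's fixed point theorem, block by block. -/

/-! ### Inverting the identity plus a contraction. -/

section FixedPoint

variable {X : Type*} [NormedAddCommGroup X]

theorem contractingWith_sub {K : ℝ≥0} (hK : K < 1) {r : X → X} (hr : LipschitzWith K r) (y : X) :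
    ContractingWith K (fun x => y - r x) :=
  ⟨hK, LipschitzWith.of_dist_le_mul fun a b => by
    rw [dist_sub_left]
    exact hr.dist_le_mul a b⟩

theorem injective_id_add {K : ℝ≥0} (hK : K < 1) {r : X → X} (hr : LipschitzWith K r) :
    Function.Injective (fun x => x + r x) := by
  intro a b hab
  refine (contractingWith_sub hK hr (b + r b)).fixedPoint_unique' (x := a) (y := b) ?_ ?_
  · simp only [Function.IsFixedPt]
    rw [← show a + r a = b + r b from hab, add_sub_cancel_right]
  · simp [Function.IsFixedPt]

variable [CompleteSpace X]

/-- The solution `x` of `x + r x = y` for a contraction `r`. -/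
noncomputable def idAddInverse {K : ℝ≥0} (hK : K < 1) {r : X → X} (hr : LipschitzWith K r)
    (y : X) : X :=
  (contractingWith_sub hK hr y).fixedPoint

theorem idAddInverse_rightInverse {K : ℝ≥0} (hK : K < 1) {r : X → X} (hr : LipschitzWith K r) :
    Function.RightInverse (idAddInverse hK hr) (fun x => x + r x) := by
  intro y
  have h := (contractingWith_sub hK hr y).fixedPoint_isFixedPt
  simp only [Function.IsFixedPt] at h
  change idAddInverse hK hr y + r (idAddInverse hK hr y) = y
  unfold idAddInverse
  nth_rw 1 [← h]
  abel

theorem idAddInverse_leftInverse {K : ℝ≥0} (hK : K < 1) {r : X → X} (hr : LipschitzWith K r) :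
    Function.LeftInverse (idAddInverse hK hr) (fun x => x + r x) :=
  fun x => injective_id_add hK hr (idAddInverse_rightInverse hK hr (x + r x))

theorem bijective_id_add {K : ℝ≥0} (hK : K < 1) {r : X → X} (hr : LipschitzWith K r) :
    Function.Bijective (fun x => x + r x) :=
  ⟨injective_id_add hK hr, (idAddInverse_rightInverse hK hr).surjective⟩

theorem tendsto_iterate_sub {K : ℝ≥0} (hK : K < 1) {r : X → X} (hr : LipschitzWith K r) (y : X) :
    Tendsto (fun n : ℕ => (fun x => y - r x)^[n] 0) atTop (𝓝 (idAddInverse hK hr y)) :=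
  (contractingWith_sub hK hr y).tendsto_iterate_fixedPoint 0

end FixedPoint

theorem iterate_fixedPointStep {X : Type*} [NormedAddCommGroup X] [InnerProductSpace ℝ X]
    (φ : ℕ → X) (N : ℕ) (NN : (Fin N → ℝ) → (Fin N → ℝ)) (n : ℕ) (x y : X) :
    (fixedPointStep φ N NN)^[n] (x, y) = ((fun z => y - rankResidual φ N NN z)^[n] x, y) := by
  induction n generalizing x with
  | zero => rfl
  | succ n ih => simp only [Function.iterate_succ_apply, fixedPointStep, ih]

theorem compBackward_leftInverse {X : Type*} (T : ℕ) (f L : Fin T → X → X)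
    (h : ∀ t, Function.LeftInverse (L t) (f t)) :
    Function.LeftInverse (compBackward T L) (compForward T f) := by
  induction T with
  | zero => exact fun _ => rfl
  | succ T ih => exact (h (Fin.last T)).comp (ih _ _ fun t => h t.castSucc)

theorem compBackward_rightInverse {X : Type*} (T : ℕ) (f L : Fin T → X → X)
    (h : ∀ t, Function.RightInverse (L t) (f t)) :
    Function.RightInverse (compBackward T L) (compForward T f) := by
  induction T with
  | zero => exact fun _ => rfl
  | succ T ih => exact (h (Fin.last T)).comp (ih _ _ fun t => h t.castSucc)

/-! ### Min and max as GroupSort layers. -/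

section GroupSort

theorem groupSort_two_zero (v : Fin 2 → ℝ) : groupSort 2 v 0 = min (v 0) (v 1) := by
  have hm : v (Tuple.sort v 0) ≤ v (Tuple.sort v 1) := Tuple.monotone_sort v (Fin.zero_le 1)
  have hne : Tuple.sort v 0 ≠ Tuple.sort v 1 := (Tuple.sort v).injective.ne (by decide)
  change v (Tuple.sort v 0) = _
  generalize Tuple.sort v 0 = i at *
  generalize Tuple.sort v 1 = j at *
  fin_cases i <;> fin_cases j <;> simp_all

theorem groupSort_two_one (v : Fin 2 → ℝ) : groupSort 2 v 1 = max (v 0) (v 1) := by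
  have hm : v (Tuple.sort v 0) ≤ v (Tuple.sort v 1) := Tuple.monotone_sort v (Fin.zero_le 1)
  have hne : Tuple.sort v 0 ≠ Tuple.sort v 1 := (Tuple.sort v).injective.ne (by decide)
  change v (Tuple.sort v 1) = _
  generalize Tuple.sort v 0 = i at *
  generalize Tuple.sort v 1 = j at *
  fin_cases i <;> fin_cases j <;> simp_all

/-- `f` is an affine function of the outputs of the layer `h`. -/
def IsAffineReadout {α ι : Type*} [Fintype ι] (h : α → ι → ℝ) (f : α → ℝ) : Prop :=
  ∃ (w : ι → ℝ) (c : ℝ), ∀ x, f x = w ⬝ᵥ h x + c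

theorem isAffineReadout_unit {α ι : Type*} [Fintype ι] (h : α → ι → ℝ) (p : ι) :
    IsAffineReadout h (fun x => h x p) := by
  classical
  exact ⟨Pi.single p 1, 0, fun x => by simp⟩

theorem IsAffineReadout.trans {α ι κ : Type*} [Fintype ι] [Fintype κ] {h : α → ι → ℝ}
    {h' : α → κ → ℝ} (hh : ∀ p, IsAffineReadout h' (fun x => h x p)) {f : α → ℝ}
    (hf : IsAffineReadout h f) : IsAffineReadout h' f := by
  obtain ⟨w, c, hf⟩ := hf
  choose w' c' hw using hh
  refine ⟨∑ p, w p • w' p, ∑ p, w p * c' p + c, fun x => ?_⟩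
  rw [hf, sum_dotProduct, dotProduct, ← add_assoc, ← Finset.sum_add_distrib]
  congr 1
  refine Finset.sum_congr rfl fun p _ => ?_
  rw [show h x p = _ from hw p x, smul_dotProduct, smul_eq_mul, mul_add]

/-- A new GroupSort layer of pairs of affine functions of the preceding layer. -/
theorem exists_hiddenLayer_pairs {m k : ℕ} {h : (Fin m → ℝ) → (Fin k × Fin 2 → ℝ)}
    (hh : IsHiddenLayer (groupSort 2) m k h) {ι : Type*} [Fintype ι]
    (f g : ι → (Fin m → ℝ) → ℝ) (hf : ∀ i, IsAffineReadout h (f i))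
    (hg : ∀ i, IsAffineReadout h (g i)) :
    ∃ (l : ℕ) (h' : (Fin m → ℝ) → (Fin l × Fin 2 → ℝ)), IsHiddenLayer (groupSort 2) m l h' ∧
      ∀ i, IsAffineReadout h' (fun x => min (f i x) (g i x)) ∧
        IsAffineReadout h' (fun x => max (f i x) (g i x)) := by
  choose wf cf hf using hf
  choose wg cg hg using hg
  let e := Fintype.equivFin ι
  let W : Matrix (Fin (Fintype.card ι) × Fin 2) (Fin k × Fin 2) ℝ :=
    Matrix.of fun p => if p.2 = 0 then wf (e.symm p.1) else wg (e.symm p.1)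
  let b : Fin (Fintype.card ι) × Fin 2 → ℝ :=
    fun p => if p.2 = 0 then cf (e.symm p.1) else cg (e.symm p.1)
  refine ⟨_, _, IsHiddenLayer.next k (Fintype.card ι) h hh W b, fun i => ⟨?_, ?_⟩⟩
  · convert isAffineReadout_unit (fun x => activate (groupSort 2) (W *ᵥ h x + b)) (e i, 0) using 2
      with x
    simp [activate, groupSort_two_zero, W, b, Matrix.mulVec, hf, hg]
  · convert isAffineReadout_unit (fun x => activate (groupSort 2) (W *ᵥ h x + b)) (e i, 1) using 2
      with x
    simp [activate, groupSort_two_one, W, b, Matrix.mulVec, hf, hg]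

/-- Pairing an old unit with itself makes sorting harmless, so the whole preceding layer survives
next to the new pair; `none` indexes the new pair and `some p` the copies. -/
theorem exists_hiddenLayer_sup_inf {m k : ℕ} {h : (Fin m → ℝ) → (Fin k × Fin 2 → ℝ)}
    (hh : IsHiddenLayer (groupSort 2) m k h) {f g : (Fin m → ℝ) → ℝ}
    (hf : IsAffineReadout h f) (hg : IsAffineReadout h g) :
    ∃ (l : ℕ) (h' : (Fin m → ℝ) → (Fin l × Fin 2 → ℝ)), IsHiddenLayer (groupSort 2) m l h' ∧
      (∀ a, IsAffineReadout h a → IsAffineReadout h' a) ∧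
      IsAffineReadout h' (fun x => min (f x) (g x)) ∧
      IsAffineReadout h' (fun x => max (f x) (g x)) := by
  obtain ⟨l, h', hh', hr⟩ := exists_hiddenLayer_pairs hh
    (fun i : Option (Fin k × Fin 2) => i.elim f fun p x => h x p)
    (fun i : Option (Fin k × Fin 2) => i.elim g fun p x => h x p)
    (by rintro (_ | p); exacts [hf, isAffineReadout_unit h p])
    (by rintro (_ | p); exacts [hg, isAffineReadout_unit h p])
  exact ⟨l, h', hh', fun a ha => ha.trans fun p => by simpa using (hr (some p)).1,
    (hr none).1, (hr none).2⟩

theorem exists_hiddenLayer_coordinates (m : ℕ) :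
    ∃ h : (Fin m → ℝ) → (Fin m × Fin 2 → ℝ), IsHiddenLayer (groupSort 2) m m h ∧
      ∀ i, IsAffineReadout h (fun x => x i) := by
  let W : Matrix (Fin m × Fin 2) (Fin m) ℝ := Matrix.of fun p => Pi.single p.1 1
  refine ⟨_, IsHiddenLayer.first m W 0, fun i => ?_⟩
  convert isAffineReadout_unit (fun x => activate (groupSort 2) (W *ᵥ x + 0)) (i, 0) using 2 with x
  simp [activate, groupSort_two_zero, W, Matrix.mulVec]

end GroupSort

/-! ### Lattice approximation of Lipschitz functions. -/

section Lattice

variable {X : Type*} [NormedAddCommGroup X] [InnerProductSpace ℝ X]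

/-- The lattice generated by the affine functions with slope at most `K`. -/
inductive IsAffineLattice (K : ℝ≥0) : (X → ℝ) → Prop
  | affine (v : X) (c : ℝ) (hv : ‖v‖ ≤ K) : IsAffineLattice K (fun x => ⟪v, x⟫ + c)
  | inf (f g : X → ℝ) (hf : IsAffineLattice K f) (hg : IsAffineLattice K g) :
      IsAffineLattice K (fun x => min (f x) (g x))
  | sup (f g : X → ℝ) (hf : IsAffineLattice K f) (hg : IsAffineLattice K g) :
      IsAffineLattice K (fun x => max (f x) (g x))

theorem IsAffineLattice.lipschitzWith {K : ℝ≥0} {f : X → ℝ} (hf : IsAffineLattice K f) :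
    LipschitzWith K f := by
  induction hf with
  | affine v c hv =>
    refine LipschitzWith.of_dist_le_mul fun x y => ?_
    rw [dist_add_right, Real.dist_eq, ← inner_sub_right, dist_eq_norm]
    exact (abs_real_inner_le_norm _ _).trans (by gcongr)
  | inf f g _ _ hf hg => simpa using hf.min hg
  | sup f g _ _ hf hg => simpa using hf.max hg

theorem IsAffineLattice.const (K : ℝ≥0) (c : ℝ) : IsAffineLattice K (fun _ : X => c) := by
  simpa using IsAffineLattice.affine (K := K) (0 : X) c (by simp)

/-- The affine interpolant with gradient along `y - x` has slope `|f y - f x| / ‖y - x‖ ≤ K`. -/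
theorem exists_isAffineLattice_eq_eq {K : ℝ≥0} {f : X → ℝ} (hf : LipschitzWith K f) (x y : X) :
    ∃ a : X → ℝ, IsAffineLattice K a ∧ a x = f x ∧ a y = f y := by
  rcases eq_or_ne x y with rfl | hxy
  · exact ⟨_, IsAffineLattice.const K (f x), rfl, rfl⟩
  have hn : 0 < ‖y - x‖ := norm_pos_iff.2 (sub_ne_zero.2 hxy.symm)
  let v : X := ((f y - f x) / ‖y - x‖ ^ 2) • (y - x)
  refine ⟨_, IsAffineLattice.affine v (f x - ⟪v, x⟫) ?_, by ring, ?_⟩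
  · have h := hf.dist_le_mul y x
    rw [Real.dist_eq, dist_eq_norm] at h
    rw [norm_smul, norm_div, norm_pow, norm_norm, Real.norm_eq_abs, div_mul_eq_mul_div,
      div_le_iff₀ (by positivity)]
    nlinarith
  · have h : ⟪v, y - x⟫ = f y - f x := by
      rw [real_inner_smul_left, real_inner_self_eq_norm_sq]
      field_simp
    rw [inner_sub_right] at h
    linarith

/-- A `K`-Lipschitz function is a uniform limit on compact sets of lattice polynomials in
affine functions of slope at most `K`. -/
theorem exists_isAffineLattice_approx {K : ℝ≥0} {f : X → ℝ} (hf : LipschitzWith K f) {S : Set X}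
    (hS : IsCompact S) {ε : ℝ} (hε : 0 < ε) :
    ∃ a : X → ℝ, IsAffineLattice K a ∧ ∀ x ∈ S, |f x - a x| ≤ ε := by
  rcases S.eq_empty_or_nonempty with rfl | ⟨x₀, hx₀⟩
  · exact ⟨_, IsAffineLattice.const K 0, by simp⟩
  -- Stone–Weierstrass argument: by compactness a minimum of finitely many interpolants through `x`
  -- stays below `f + ε`; a finite maximum over `x` then also stays above `f - ε`.
  have upper (x : X) : ∃ a : X → ℝ, IsAffineLattice K a ∧ a x = f x ∧ ∀ z ∈ S, a z < f z + ε := by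
    refine hS.induction_on
      (p := fun t => ∃ a : X → ℝ, IsAffineLattice K a ∧ a x = f x ∧ ∀ z ∈ t, a z < f z + ε)
      ⟨_, IsAffineLattice.const K (f x), rfl, by simp⟩ ?_ ?_ ?_
    · rintro s t hst ⟨a, ha, hx, h⟩
      exact ⟨a, ha, hx, fun z hz => h z (hst hz)⟩
    · rintro s t ⟨a, ha, hax, hat⟩ ⟨b, hb, hbx, hbt⟩
      refine ⟨_, ha.inf _ _ hb, by simp [hax, hbx], ?_⟩
      rintro z (hz | hz)
      exacts [(min_le_left _ _).trans_lt (hat z hz), (min_le_right _ _).trans_lt (hbt z hz)]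
    · intro y _
      obtain ⟨a, ha, hax, hay⟩ := exists_isAffineLattice_eq_eq hf x y
      refine ⟨{z | a z < f z + ε}, mem_nhdsWithin_of_mem_nhds ?_, a, ha, hax, fun z hz => hz⟩
      refine (isOpen_lt ha.lipschitzWith.continuous
        (hf.continuous.add continuous_const)).mem_nhds ?_
      simp [hay, hε]
  obtain ⟨a, ha, hau, hal⟩ : ∃ a : X → ℝ, IsAffineLattice K a ∧ (∀ z ∈ S, a z < f z + ε) ∧
      ∀ z ∈ S, f z - ε < a z := by
    refine hS.induction_on
      (p := fun t => ∃ a : X → ℝ, IsAffineLattice K a ∧ (∀ z ∈ S, a z < f z + ε) ∧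
        ∀ z ∈ t, f z - ε < a z) ?_ ?_ ?_ ?_
    · obtain ⟨a, ha, -, h⟩ := upper x₀
      exact ⟨a, ha, h, by simp⟩
    · rintro s t hst ⟨a, ha, hx, h⟩
      exact ⟨a, ha, hx, fun z hz => h z (hst hz)⟩
    · rintro s t ⟨a, ha, hax, hat⟩ ⟨b, hb, hbx, hbt⟩
      refine ⟨_, ha.sup _ _ hb, fun z hz => max_lt (hax z hz) (hbx z hz), ?_⟩
      rintro z (hz | hz)
      exacts [(hat z hz).trans_le (le_max_left _ _), (hbt z hz).trans_le (le_max_right _ _)]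
    · intro y _
      obtain ⟨a, ha, hay, h⟩ := upper y
      refine ⟨{z | f z - ε < a z}, mem_nhdsWithin_of_mem_nhds ?_, a, ha, h, fun z hz => hz⟩
      refine (isOpen_lt (hf.continuous.sub continuous_const)
        ha.lipschitzWith.continuous).mem_nhds ?_
      simp [hay, hε]
  exact ⟨a, ha, fun x hx => abs_le.2 ⟨by linarith [hau x hx], by linarith [hal x hx]⟩⟩

/-- Keeping all readouts of `h` lets the two arguments of a min or max be computed one after the
other, at unequal depths, in a single network. -/
theorem IsAffineLattice.exists_hiddenLayer {K : ℝ≥0} {f : X → ℝ} (hf : IsAffineLattice K f)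
    (φ : ℕ → X) {m k : ℕ} {h : (Fin m → ℝ) → (Fin k × Fin 2 → ℝ)}
    (hh : IsHiddenLayer (groupSort 2) m k h) (hc : ∀ i, IsAffineReadout h (fun x => x i)) :
    ∃ (l : ℕ) (h' : (Fin m → ℝ) → (Fin l × Fin 2 → ℝ)), IsHiddenLayer (groupSort 2) m l h' ∧
      (∀ a, IsAffineReadout h a → IsAffineReadout h' a) ∧
      IsAffineReadout h' (f ∘ decoder φ m) := by
  induction hf generalizing k with
  | affine v c hv =>
    refine ⟨k, h, hh, fun _ ha => ha, IsAffineReadout.trans (h := fun x => x) hc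
      ⟨fun i => ⟪v, φ i⟫, c, fun x => ?_⟩⟩
    simp [decoder, inner_sum, real_inner_smul_right, dotProduct, mul_comm]
  | inf f g _ _ hf hg =>
    obtain ⟨_, h₁, hh₁, hk₁, hf₁⟩ := hf hh hc
    obtain ⟨_, h₂, hh₂, hk₂, hg₂⟩ := hg hh₁ fun i => hk₁ _ (hc i)
    obtain ⟨_, h₃, hh₃, hk₃, hmin, -⟩ := exists_hiddenLayer_sup_inf hh₂ (hk₂ _ hf₁) hg₂
    exact ⟨_, h₃, hh₃, fun a ha => hk₃ _ (hk₂ _ (hk₁ _ ha)), hmin⟩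
  | sup f g _ _ hf hg =>
    obtain ⟨_, h₁, hh₁, hk₁, hf₁⟩ := hf hh hc
    obtain ⟨_, h₂, hh₂, hk₂, hg₂⟩ := hg hh₁ fun i => hk₁ _ (hc i)
    obtain ⟨_, h₃, hh₃, hk₃, -, hmax⟩ := exists_hiddenLayer_sup_inf hh₂ (hk₂ _ hf₁) hg₂
    exact ⟨_, h₃, hh₃, fun a ha => hk₃ _ (hk₂ _ (hk₁ _ ha)), hmax⟩

theorem isNeuralNetwork_of_isAffineLattice {K : ℝ≥0} (φ : ℕ → X) {m n : ℕ} (f : Fin n → X → ℝ)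
    (hf : ∀ i, IsAffineLattice K (f i)) :
    IsNeuralNetwork (groupSort 2) (fun (x : Fin m → ℝ) i => f i (decoder φ m x)) := by
  have key (s : Finset (Fin n)) : ∃ (l : ℕ) (h : (Fin m → ℝ) → (Fin l × Fin 2 → ℝ)),
      IsHiddenLayer (groupSort 2) m l h ∧ (∀ i, IsAffineReadout h (fun x => x i)) ∧
      ∀ i ∈ s, IsAffineReadout h (f i ∘ decoder φ m) := by
    induction s using Finset.induction_on with
    | empty =>
      obtain ⟨h, hh, hc⟩ := exists_hiddenLayer_coordinates m
      exact ⟨m, h, hh, hc, by simp⟩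
    | insert j s _ ih =>
      obtain ⟨l, h, hh, hc, hs⟩ := ih
      obtain ⟨l', h', hh', hk, hj⟩ := (hf j).exists_hiddenLayer φ hh hc
      refine ⟨l', h', hh', fun i => hk _ (hc i), fun i hi => ?_⟩
      rcases Finset.mem_insert.1 hi with rfl | hi
      exacts [hj, hk _ (hs i hi)]
  obtain ⟨l, h, hh, -, hr⟩ := key Finset.univ
  choose w c hw using fun i => hr i (Finset.mem_univ i)
  exact ⟨l, h, hh, Matrix.of w, c, funext fun x => funext fun i => hw i x⟩

end Lattice

/-! ### Approximating and composing residual blocks. -/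

section Approximation

variable {X : Type*} [NormedAddCommGroup X] [InnerProductSpace ℝ X]

theorem norm_decoder_le {φ : ℕ → X} {N : ℕ} (hφ : ∀ i : Fin N, ‖φ i‖ = 1) (a : Fin N → ℝ) :
    ‖decoder φ N a‖ ≤ ∑ i, |a i| := by
  refine (norm_sum_le _ _).trans_eq (Finset.sum_congr rfl fun i _ => ?_)
  rw [norm_smul, hφ, mul_one, Real.norm_eq_abs]

theorem decoder_sub (φ : ℕ → X) (N : ℕ) (a b : Fin N → ℝ) :
    decoder φ N (a - b) = decoder φ N a - decoder φ N b := by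
  simp [decoder, sub_smul]

/-- Lipschitz maps with a small constant are uniform limits on compact sets of residuals that
are `δ`-Lipschitz GroupSort networks. -/
theorem exists_rankResidual_approx {φ : ℕ → X} {N : ℕ} (hφ : ∀ i : Fin N, ‖φ i‖ = 1)
    (hDE : ∀ x, decoder φ N (encoder φ N x) = x) {K δ : ℝ≥0} (hK : N * K ≤ δ) {g : X → X}
    (hg : LipschitzWith K g) {S : Set X} (hS : IsCompact S) {ε : ℝ} (hε : 0 < ε) :
    ∃ NN : (Fin N → ℝ) → (Fin N → ℝ), IsNeuralNetwork (groupSort 2) NN ∧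
      LipschitzWith δ (rankResidual φ N NN) ∧ ∀ x ∈ S, ‖g x - rankResidual φ N NN x‖ ≤ ε := by
  have hcomp (i : Fin N) : LipschitzWith K (fun x => ⟪g x, φ i⟫) := by
    refine LipschitzWith.of_dist_le_mul fun x y => ?_
    rw [Real.dist_eq, ← inner_sub_left]
    refine (abs_real_inner_le_norm _ _).trans ?_
    rw [hφ, mul_one, ← dist_eq_norm]
    exact hg.dist_le_mul x y
  -- The `N` coordinate errors add up to at most `ε`; the `+ 1` keeps the denominator nonzero when
  -- `N = 0`.
  choose a ha hag using fun i =>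
    exists_isAffineLattice_approx (hcomp i) hS (show 0 < ε / (N + 1) by positivity)
  have hres (x : X) : rankResidual φ N (fun x i => a i (decoder φ N x)) x =
      decoder φ N (fun i => a i x) := by simp [rankResidual, hDE]
  refine ⟨_, isNeuralNetwork_of_isAffineLattice φ a ha, ?_, fun x hx => ?_⟩
  · refine LipschitzWith.of_dist_le_mul fun x y => ?_
    rw [hres, hres, dist_eq_norm, ← decoder_sub]
    calc _ ≤ ∑ i : Fin N, |a i x - a i y| := norm_decoder_le hφ _
      _ ≤ ∑ _i : Fin N, K * dist x y :=
        Finset.sum_le_sum fun i _ => (ha i).lipschitzWith.dist_le_mul x y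
      _ = (N * K : ℝ≥0) * dist x y := by simp [mul_assoc]
      _ ≤ δ * dist x y := by gcongr
  · rw [hres]
    nth_rw 1 [← hDE (g x)]
    rw [← decoder_sub]
    calc _ ≤ ∑ i : Fin N, |⟪g x, φ i⟫ - a i x| := norm_decoder_le hφ _
      _ ≤ ∑ _i : Fin N, ε / (N + 1) := Finset.sum_le_sum fun i _ => hag i x hx
      _ = N / (N + 1) * ε := by simp; ring
      _ ≤ ε := mul_le_of_le_one_left hε.le (by rw [div_le_one (by positivity)]; linarith)

/-- `H` is a uniform limit on balls of invertible residual networks with `T` blocks. -/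
def IsResNetLimit (T N : ℕ) (φ : ℕ → X) (δ : ℝ≥0) (H : X → X) : Prop :=
  ∀ R ε : ℝ, 0 < ε → ∃ NN : Fin T → (Fin N → ℝ) → (Fin N → ℝ),
    IsInvBlockFamily T N φ δ (groupSort 2) NN ∧
      ∀ u ∈ closedBall (0 : X) R, ‖H u - resNetMap φ T N NN u‖ ≤ ε

theorem isResNetLimit_id (N : ℕ) (φ : ℕ → X) (δ : ℝ≥0) : IsResNetLimit 0 N φ δ id :=
  fun _ _ hε => ⟨Fin.elim0, fun t => t.elim0, fun u _ => by simp [resNetMap, compForward, hε.le]⟩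

theorem resNetMap_snoc (φ : ℕ → X) (T N : ℕ) (NN : Fin T → (Fin N → ℝ) → (Fin N → ℝ))
    (f : (Fin N → ℝ) → (Fin N → ℝ)) (u : X) :
    resNetMap φ (T + 1) N (Fin.snoc (α := fun _ => (Fin N → ℝ) → (Fin N → ℝ)) NN f) u =
      resNetMap φ T N NN u + rankResidual φ N f (resNetMap φ T N NN u) := by
  simp [resNetMap, compForward]

theorem IsResNetLimit.comp [ProperSpace X] {T N : ℕ} {φ : ℕ → X} (hφ : ∀ i : Fin N, ‖φ i‖ = 1)
    (hDE : ∀ x, decoder φ N (encoder φ N x) = x) {K δ : ℝ≥0} (hK : N * K ≤ δ) (hK1 : K ≤ 1)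
    {g H : X → X} (hg : LipschitzWith K g) (hHc : Continuous H) (hH : IsResNetLimit T N φ δ H) :
    IsResNetLimit (T + 1) N φ δ (fun x => H x + g (H x)) := by
  intro R ε hε
  obtain ⟨NN, hNN, hNNa⟩ := hH R (ε / 4) (by positivity)
  -- The new block is fed the network's output, which is only close to the image of `H`; the
  -- thickening contains it and is compact because `X` is proper.
  have hS : IsCompact (cthickening (ε / 4) (H '' closedBall 0 R)) :=
    ((isCompact_closedBall 0 R).image hHc).cthickening
  obtain ⟨f, hf, hfL, hfa⟩ := exists_rankResidual_approx hφ hDE hK hg hS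
    (show 0 < ε / 4 by positivity)
  refine ⟨Fin.snoc (α := fun _ => (Fin N → ℝ) → (Fin N → ℝ)) NN f, ?_, fun u hu => ?_⟩
  · intro t
    induction t using Fin.lastCases with
    | last => simpa using ⟨hf, hfL⟩
    | cast t => simpa using hNN t
  · rw [resNetMap_snoc]
    set G := resNetMap φ T N NN u
    have h1 : ‖H u - G‖ ≤ ε / 4 := hNNa u hu
    have hGS : G ∈ cthickening (ε / 4) (H '' closedBall 0 R) :=
      mem_cthickening_of_dist_le G (H u) _ _ (mem_image_of_mem H hu)
        (by rwa [dist_comm, dist_eq_norm])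
    have h2 := hfa G hGS
    have h3 : ‖g (H u) - g G‖ ≤ ‖H u - G‖ := by
      have := hg.dist_le_mul (H u) G
      rw [dist_eq_norm, dist_eq_norm] at this
      exact this.trans (mul_le_of_le_one_left (norm_nonneg _) hK1)
    calc ‖H u + g (H u) - (G + rankResidual φ N f G)‖
        = ‖(H u - G) + (g (H u) - g G) + (g G - rankResidual φ N f G)‖ := by congr 1; abel
      _ ≤ ‖H u - G‖ + ‖g (H u) - g G‖ + ‖g G - rankResidual φ N f G‖ := norm_add₃_le
      _ ≤ ε := by linarith

end Approximation

/-! ### The segment from the identity to `F`. -/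

section Homotopy

variable {X : Type*} [NormedAddCommGroup X] [InnerProductSpace ℝ X]

/-- A convex combination of the identity and `F` is strongly monotone with constant `min 1 α`,
whatever `t` is; Cauchy–Schwarz gives the rest. -/
theorem StronglyMonotone.antilipschitz_homotopy {P : X → X}
    (hF : StronglyMonotone fun x => x + P x) :
    ∃ a : ℝ≥0, ∀ t : ℝ, 0 ≤ t → t ≤ 1 → AntilipschitzWith a (fun x => x + t • P x) := by
  obtain ⟨α, hα, h⟩ := hF
  have hm : 0 < min 1 α := lt_min one_pos hα
  refine ⟨(min 1 α)⁻¹.toNNReal, fun t ht0 ht1 =>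
    AntilipschitzWith.of_le_mul_dist fun x y => ?_⟩
  rw [dist_eq_norm, dist_eq_norm, Real.coe_toNNReal _ (by positivity), ← div_eq_inv_mul, le_div_iff₀ hm]
  have h1 := h x y
  have h2 : ⟪x + t • P x - (y + t • P y), x - y⟫ =
      (1 - t) * ‖x - y‖ ^ 2 + t * ⟪x + P x - (y + P y), x - y⟫ := by
    rw [← real_inner_self_eq_norm_sq, ← real_inner_smul_left, ← real_inner_smul_left,
      ← inner_add_left]
    congr 1
    module
  have h3 : min 1 α * ‖x - y‖ ^ 2 ≤ ‖x + t • P x - (y + t • P y)‖ * ‖x - y‖ := by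
    refine le_trans ?_ (real_inner_le_norm _ _)
    rw [h2]
    have e1 : min 1 α * ‖x - y‖ ^ 2 ≤ ‖x - y‖ ^ 2 :=
      mul_le_of_le_one_left (by positivity) (min_le_left _ _)
    have e2 : min 1 α * ‖x - y‖ ^ 2 ≤ α * ‖x - y‖ ^ 2 := by gcongr; exact min_le_right _ _
    nlinarith [mul_le_mul_of_nonneg_left (e2.trans h1) ht0,
      mul_le_mul_of_nonneg_left e1 (sub_nonneg.2 ht1)]
  rcases (norm_nonneg (x - y)).eq_or_lt with h0 | h0
  · rw [← h0]; simp
  · refine le_of_mul_le_mul_right ?_ h0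
    nlinarith

/-- A strongly monotone Lipschitz perturbation of the identity is a limit of invertible residual
networks: the segment from the identity to it is cut into small steps. -/
theorem exists_isResNetLimit_of_stronglyMonotone [ProperSpace X] {N : ℕ} {φ : ℕ → X} (hN : 0 < N)
    (hφ : ∀ i : Fin N, ‖φ i‖ = 1) (hDE : ∀ x, decoder φ N (encoder φ N x) = x) {δ : ℝ≥0}
    (hδ0 : 0 < δ) (hδ1 : δ < 1) {P : X → X} {C : ℝ≥0} (hP : LipschitzWith C P)
    (hF : StronglyMonotone fun x => x + P x) :
    ∃ T, 0 < T ∧ IsResNetLimit T N φ δ (fun x => x + P x) := by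
  obtain ⟨a, hanti⟩ := hF.antilipschitz_homotopy
  -- Enough steps that `N * (C * a / n) ≤ δ`; the factor `N` pays for coordinatewise approximation.
  obtain ⟨n, hn⟩ := exists_nat_gt (N * C * a / δ)
  have hn0 : (0 : ℝ≥0) < n := lt_of_le_of_lt (zero_le) hn
  rw [div_lt_iff₀ hδ0] at hn
  set K : ℝ≥0 := (n : ℝ≥0)⁻¹ * (C * a) with hKdef
  have hK : N * K ≤ δ := by
    rw [hKdef, mul_left_comm, ← div_eq_inv_mul, div_le_iff₀ hn0]
    calc _ = N * C * a := by ring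
      _ ≤ n * δ := hn.le
      _ = _ := mul_comm _ _
  have hK1 : K < 1 := by
    have : (1 : ℝ≥0) ≤ N := by exact_mod_cast hN
    calc K = 1 * K := (one_mul K).symm
      _ ≤ N * K := by gcongr
      _ ≤ δ := hK
      _ < 1 := hδ1
  -- Bijectivity is carried along because the next increment is defined through the inverse of `H`;
  -- it propagates since `Id + g` is bijective for a contraction `g`.
  have key (j : ℕ) (hj : j ≤ n) : Function.Bijective (fun x => x + ((j : ℝ) / n) • P x) ∧
      IsResNetLimit j N φ δ (fun x => x + ((j : ℝ) / n) • P x) := by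
    induction j with
    | zero => simpa using ⟨Function.bijective_id, isResNetLimit_id N φ δ⟩
    | succ j ih =>
      obtain ⟨hb, hl⟩ := ih (by omega)
      set H : X → X := fun x => x + ((j : ℝ) / n) • P x with hHdef
      have hjn : (j : ℝ) / n ≤ 1 := by
        rw [div_le_one (by exact_mod_cast hn0)]
        exact_mod_cast (show j ≤ n by omega)
      have hHc : Continuous H := continuous_id.add (hP.continuous.const_smul _)
      obtain ⟨I, hI1, hI2⟩ := Function.bijective_iff_has_inverse.1 hb
      have hIL : LipschitzWith a I := (hanti _ (by positivity) hjn).to_rightInverse hI2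
      let g : X → X := fun x => (n : ℝ)⁻¹ • P (I x)
      have hg : LipschitzWith K g := by
        refine LipschitzWith.of_dist_le_mul fun x y => ?_
        rw [dist_smul₀, hKdef]
        have := (hP.comp hIL).dist_le_mul x y
        simp only [NNReal.coe_mul, NNReal.coe_inv, NNReal.coe_natCast, norm_inv,
          Real.norm_natCast, Function.comp] at this ⊢
        rw [mul_assoc]
        gcongr
      have heq : (fun x => x + (((j + 1 : ℕ) : ℝ) / n) • P x) = (fun x => x + g x) ∘ H := by
        funext x
        simp only [Function.comp, g, hI1 x]
        simp only [hHdef]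
        push_cast
        rw [add_div, add_smul, one_div, add_assoc]
      refine ⟨?_, ?_⟩
      · rw [heq]
        exact (bijective_id_add hK1 hg).comp hb
      · rw [heq]
        exact hl.comp hφ hDE hK hK1.le hg hHc
  refine ⟨n, by exact_mod_cast hn0, ?_⟩
  have hn1 : (n : ℝ) / n = 1 := div_self (by exact_mod_cast hn0.ne')
  simpa [hn1] using (key n le_rfl).2

end Homotopy

/-! ### Orthonormal bases in finite dimension. -/

section Basis

variable {X : Type*} [NormedAddCommGroup X] [InnerProductSpace ℝ X] {d : ℕ∞} {φ : ℕ → X}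

theorem IsSeqOrthonormalBasis.pos [Nontrivial X] (hφ : IsSeqOrthonormalBasis d φ) : 0 < d := by
  by_contra h
  obtain rfl : d = 0 := by simpa using h
  have := hφ.dense_span
  simp at this

theorem IsSeqOrthonormalBasis.norm_eq_one (hφ : IsSeqOrthonormalBasis d φ) {n : ℕ}
    (hn : (n : ℕ∞) < d) : ‖φ n‖ = 1 :=
  hφ.orthonormal.1 ⟨n, hn⟩

theorem IsSeqOrthonormalBasis.ne_top [FiniteDimensional ℝ X] (hφ : IsSeqOrthonormalBasis d φ) :
    d ≠ ⊤ := by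
  rintro rfl
  have := hφ.orthonormal.linearIndependent.finite
  have : Infinite {n : ℕ // (n : ℕ∞) < ⊤} :=
    Infinite.of_injective (fun n : ℕ => ⟨n, ENat.natCast_lt_top n⟩) fun a b h => by simpa using h
  exact not_finite {n : ℕ // (n : ℕ∞) < ⊤}

theorem IsSeqOrthonormalBasis.decoder_encoder [FiniteDimensional ℝ X] {N : ℕ}
    (hφ : IsSeqOrthonormalBasis (N : ℕ∞) φ) (x : X) : decoder φ N (encoder φ N x) = x := by
  have horth : Orthonormal ℝ (fun i : Fin N => φ i) :=
    hφ.orthonormal.comp (fun i : Fin N => ⟨i, by exact_mod_cast i.2⟩)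
      fun i j h => Fin.ext (by simpa using h)
  have hspan : ⊤ ≤ Submodule.span ℝ (range fun i : Fin N => φ i) := by
    have h := hφ.dense_span
    rw [(Submodule.closed_of_finiteDimensional _).submodule_topologicalClosure_eq] at h
    rw [← h]
    refine Submodule.span_mono ?_
    rintro _ ⟨n, hn, rfl⟩
    exact ⟨⟨n, by simpa using hn⟩, rfl⟩
  have h := (OrthonormalBasis.mk horth hspan).sum_repr' x
  simpa [decoder, encoder, real_inner_comm] using h

end Basis

/-! ### The identity as a network, and the main theorem. -/

theorem exists_invResNets_id {X : Type*} [NormedAddCommGroup X] [InnerProductSpace ℝ X]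
    (φ : ℕ → X) (δ : ℝ≥0) : id ∈ invResNets 1 1 φ δ (groupSort 2) := by
  have h := isNeuralNetwork_of_isAffineLattice (K := 0) φ (m := 1) (n := 1) (fun _ _ => 0)
    fun _ => IsAffineLattice.const 0 0
  have hr : rankResidual φ 1 (fun _ _ => 0) = fun _ => 0 := by
    funext x
    simp [rankResidual, decoder]
  refine ⟨fun _ _ _ => 0, fun _ => ⟨h, ?_⟩, ?_⟩
  · rw [hr]
    exact (LipschitzWith.const 0).weaken (zero_le)
  · funext x
    simp [resNetMap, compForward, hr]

theorem mainTheorem7 {X : Type*} [NormedAddCommGroup X] [InnerProductSpace ℝ X]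
    [CompleteSpace X] [Nontrivial X]
    (R : ℝ) (hR : 0 < R)
    (F : X ≃ₘ^1⟮𝓘(ℝ, X), 𝓘(ℝ, X)⟯ X) (hmono : StronglyMonotone F) (hsupp : IsCompact (moveSupport F))
    (d : ℕ∞) (φ : ℕ → X) (hφ : IsSeqOrthonormalBasis d φ)
    (δ : ℝ≥0) (hδ0 : 0 < δ) (hδ1 : δ < 1) (ε : ℝ) (hε0 : 0 < ε) (hε1 : ε < 1) :
    (∃ T N : ℕ, 0 < T ∧ 0 < N ∧ (N : ℕ∞) ≤ d ∧
      ∃ G ∈ invResNets T N φ δ (groupSort 2),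
        ∀ u ∈ closedBall (0 : X) R, ‖F u - G u‖ ≤ ε) ∧
    (∀ (T N : ℕ) (NN : Fin T → (Fin N → ℝ) → (Fin N → ℝ)), (N : ℕ∞) ≤ d →
      IsInvBlockFamily T N φ δ (groupSort 2) NN →
      ∃ L : Fin T → X → X,
        (∀ t y, Tendsto (fun n : ℕ => ((fixedPointStep φ N (NN t))^[n] (0, y)).1) atTop
          (𝓝 (L t y))) ∧
        Function.LeftInverse (compBackward T L) (resNetMap φ T N NN) ∧
        Function.RightInverse (compBackward T L) (resNetMap φ T N NN)) := by
  refine ⟨?_, fun T N NN _ hNN => ⟨fun t => idAddInverse hδ1 (hNN t).2, fun t y => ?_,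
    compBackward_leftInverse T _ _ fun t => idAddInverse_leftInverse hδ1 (hNN t).2,
    compBackward_rightInverse T _ _ fun t => idAddInverse_rightInverse hδ1 (hNN t).2⟩⟩
  · let P : X → X := fun x => F x - x
    have hFP : ⇑F = fun x => x + P x := by simp [P]
    have hPd : ContDiff ℝ 1 P := F.contMDiff.contDiff.sub contDiff_id
    have hPs : HasCompactSupport P := by
      have : moveSupport F = tsupport P := by
        simp [moveSupport, tsupport, Function.support, P, sub_eq_zero]
      rwa [this] at hsupp
    -- A nonzero continuous map has an open set of nonzero points, which lies in a compact set only
    -- if the space is locally compact, hence finite-dimensional.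
    rcases hPs.eq_zero_or_finiteDimensional ℝ hPd.continuous with h0 | hfin
    · refine ⟨1, 1, one_pos, one_pos, ?_, id, exists_invResNets_id φ δ, fun u _ => ?_⟩
      · simpa [Order.one_le_iff_pos] using hφ.pos
      · simpa [hFP, h0] using hε0.le
    · lift d to ℕ using hφ.ne_top
      have := FiniteDimensional.proper_real X
      obtain ⟨C, hC⟩ := hPd.lipschitzWith_of_hasCompactSupport hPs one_ne_zero
      have hd : 0 < d := by exact_mod_cast hφ.pos
      rw [hFP] at hmono ⊢
      obtain ⟨T, hT, hlim⟩ := exists_isResNetLimit_of_stronglyMonotone hd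
        (fun i => hφ.norm_eq_one (by exact_mod_cast i.2)) hφ.decoder_encoder hδ0 hδ1 hC hmono
      obtain ⟨NN, hNN, h⟩ := hlim R ε hε0
      exact ⟨T, d, hT, hd, le_rfl, _, ⟨NN, hNN, rfl⟩, h⟩
  · simp only [iterate_fixedPointStep]
    exact tendsto_iterate_sub hδ1 (hNN t).2 y
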